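/- Setting. Let $\mathcal X$ be a measurable space, let $\mathcal Y=\mathcal Y_1\times\dots\times\mathcal Y_\ell$ with finite sets $\mathcal Y_j$, and let $D$ be a probability distribution on $\mathcal X\times\mathcal Y$. Let $\mathcal C$ be a finite set of cliques $c\subseteq\{1,\dots,\ell\}$; write $\mathcal Y_c=\prod_{j\in c}\mathcal Y_j$, write $y_c$ for the restriction of $y\in\mathcal Y$ to $c$, and let $m=\sum_{c\in\mathcal C}|\mathcal Y_c|$ be the total number of clique assignments. There are $P\ge 1$ sub-models; sub-model $p$ has measurable clique features $\mathbf f^{p}_c(x,y_c)\in\mathbb R^d$ (which may be the same for all $p$), a parameter vector $\theta_p\in\mathbb R^d$, and the score $\theta_p(x,y)=\sum_{c\in\mathcal C}\theta_p^\top\mathbf f^{p}_c(x,y_c)$. Its max-marginals and threshold are $$\theta^\star_p(x,y_c)=\max_{y'\in\mathcal Y:\,y'_c=y_c}\theta_p(x,y'),\qquad \tau(x;\theta_p,\alpha)=\alpha\max_{y\in\mathcal Y}\theta_p(x,y)+(1-\alpha)\frac1m\sum_{c\in\mathcal C}\sum_{y_c\in\mathcal Y_c}\theta^\star_p(x,y_c).$$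 For $\gamma>0$ let $r_\gamma(z)=1$ if $z<0$, $r_\gamma(z)=1-z/\gamma$ if $0\le z\le\gamma$, and $r_\gamma(z)=0$ if $z>\gamma$. For $\theta=(\theta_1,\dots,\theta_P)$, the joint filtering loss and its $\gamma$-margin version are $$\mathcal L_{joint}(x,y;\theta,\alpha)=\mathbf 1\Big[\sum_p\theta_p(x,y)\le\sum_p\tau(x;\theta_p,\alpha)\Big],\qquad \mathcal L^\gamma_{joint}(x,y;\theta,\alpha)=r_\gamma\Big(\sum_p\big(\theta_p(x,y)-\tau(x;\theta_p,\alpha)\big)\Big).$$ Theorem. There is an absolute constant $c>0$ such that the following holds in every such setting. Fix $\alpha\in[0,1]$, $\gamma>0$ and $B$, and suppose that $\|\mathbf f^{p}_c(x,y_c)\|_2\le 1$ for all $p$, $x$, $c\in\mathcal C$ and $y_c\in\mathcal Y_c$. Then for every integer $n\ge 1$ and every $0<\delta<1$, with probability at least $1-\delta$ over samples of $n$ independent draws from $D$, every $\theta=(\theta_1,\dots,\theta_P)$ with $\|\theta_p\|_2\le B/P$ for all $p$ satisfies $$\mathbb E\left[\mathcal L_{joint}(X,Y;\theta,\alpha)\right]\le\hat{\mathbb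 E}\left[\mathcal L^\gamma_{joint}(X,Y;\theta,\alpha)\right]+\frac{c\,m\,B\,P\sqrt{|\mathcal C|}}{\gamma\sqrt n}+\sqrt{\frac{8\ln(2/\delta)}{n}},$$ where $(X,Y)\sim D$ and $\hat{\mathbb E}$ is the empirical expectation with respect to the sample. -/

import Mathlib

open MeasureTheory

noncomputable section

namespace SPC

/-- The output space: vectors of `ℓ` discrete variables, the `j`-th one taking `K j` values. -/
abbrev Output {ℓ : ℕ} (K : Fin ℓ → ℕ) : Type := ∀ j : Fin ℓ, Fin (K j)

/-- The set of all assignments to the variables of a clique `c`. The assignment that an output `y`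
induces on `c` is `c.restrict y`. -/
abbrev CliqueAssignment {ℓ : ℕ} (K : Fin ℓ → ℕ) (c : Finset (Fin ℓ)) : Type :=
  ∀ j : c, Fin (K j)

/-- Clique features: a `d`-dimensional vector for each input `x`, clique `c` and assignment to
`c`. -/
abbrev CliqueFeatures {ℓ : ℕ} (K : Fin ℓ → ℕ) (X : Type*) (d : ℕ) :=
  X → (c : Finset (Fin ℓ)) → CliqueAssignment K c → EuclideanSpace ℝ (Fin d)

variable {ℓ : ℕ} {K : Fin ℓ → ℕ} {X : Type*} {d P n : ℕ}

/-- The total number of clique assignments of a set `C` of cliques. -/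
def numAssignments (K : Fin ℓ → ℕ) (C : Finset (Finset (Fin ℓ))) : ℕ :=
  ∑ c ∈ C, Fintype.card (CliqueAssignment K c)

/-- The joint feature vector of an input/output pair, decomposed over the cliques. -/
def featureMap (C : Finset (Finset (Fin ℓ))) (f : CliqueFeatures K X d) (x : X) (y : Output K) :
    EuclideanSpace ℝ (Fin d) :=
  ∑ c ∈ C, f x c (c.restrict y)

/-- The linear score of the output `y` on the input `x`. -/
def score (C : Finset (Finset (Fin ℓ))) (f : CliqueFeatures K X d)
    (θ : EuclideanSpace ℝ (Fin d)) (x : X) (y : Output K) : ℝ :=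
  inner ℝ θ (featureMap C f x y)

/-- The max-marginal of an assignment `a` to the clique `c`: the largest score of an output that is
consistent with `a`. -/
def maxMarginal (C : Finset (Finset (Fin ℓ))) (f : CliqueFeatures K X d)
    (θ : EuclideanSpace ℝ (Fin d)) (x : X) (c : Finset (Fin ℓ)) (a : CliqueAssignment K c) : ℝ :=
  ⨆ y : {y : Output K // c.restrict y = a}, score C f θ x y

/-- The max-mean-max threshold. -/
def threshold (C : Finset (Finset (Fin ℓ))) (f : CliqueFeatures K X d)
    (θ : EuclideanSpace ℝ (Fin d)) (α : ℝ) (x : X) : ℝ :=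
  α * (⨆ y : Output K, score C f θ x y) +
    (1 - α) * (1 / (numAssignments K C : ℝ) *
      ∑ c ∈ C, ∑ a : CliqueAssignment K c, maxMarginal C f θ x c a)

/-- The `γ`-margin function. -/
def ramp (γ z : ℝ) : ℝ :=
  if z < 0 then 1 else if z ≤ γ then 1 - z / γ else 0

open Classical in
/-- The joint filtering loss of an ensemble of `P` sub-models with features `f p` and parameters
`θ p`. -/
def jointLoss (C : Finset (Finset (Fin ℓ))) (f : Fin P → CliqueFeatures K X d)
    (θ : Fin P → EuclideanSpace ℝ (Fin d)) (α : ℝ) (x : X) (y : Output K) : ℝ :=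
  if ∑ p, score C (f p) (θ p) x y ≤ ∑ p, threshold C (f p) (θ p) α x then 1 else 0

/-- The margin-augmented joint filtering loss. -/
def jointMarginLoss (C : Finset (Finset (Fin ℓ))) (f : Fin P → CliqueFeatures K X d)
    (θ : Fin P → EuclideanSpace ℝ (Fin d)) (α γ : ℝ) (x : X) (y : Output K) : ℝ :=
  ramp γ (∑ p, (score C (f p) (θ p) x y - threshold C (f p) (θ p) α x))

/-- The empirical expectation of `g` over a sample of size `n`. -/
def empiricalMean (S : Fin n → X × Output K) (g : X → Output K → ℝ) : ℝ :=
  1 / (n : ℝ) * ∑ i, g (S i).1 (S i).2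

end SPC

end

/-! ### Moments of random signs. -/

section Signs

open scoped BigOperators

variable {ι : Type*} [Fintype ι] [DecidableEq ι]

/-! The ramp dominates the 0-1 filtering loss, so it suffices to bound, uniformly in `θ`, the gap
between true and empirical margin loss. Bounded differences concentrate the largest gap around its
mean, and symmetrization bounds that mean by twice the Rademacher complexity of the margin losses.

The margin loss at one point depends on `θ` only through the `P * m` clique scores, each linear in
`θ`. Scores, maxima and averages of maxima move by at most `|C| * M` when every clique score moves
by at most `M`, and the ramp is `1/γ`-Lipschitz, so the loss is Lipschitz in the sup norm with
constant `L = 2 |C| P / γ`. The vector contraction `expect_signs_ciSup_le` then replaces the single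
sign of a sample point by one independent sign per clique score. It costs no further constant,
because the trivial Khintchine bound `abs_le_expect_abs_sum_sign_mul` controls each coordinate,
hence the sup norm, by the mean absolute signed sum.

What remains is a linear class: the concatenated parameter has norm at most `B / √P`, and there are
`n * P * m` feature vectors of norm at most 1, so Cauchy-Schwarz and orthogonality of signs give `L
* B * √(n m)`. Doubling, dividing by `n` and using `|C| ≤ m` gives the stated rate. -/

theorem Finset.expect_intUnits (F : ℤˣ → ℝ) : 𝔼 s : ℤˣ, F s = (F 1 + F (-1)) / 2 := by
  rw [Fintype.expect_eq_sum_div_card]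
  simp [UnitsInt.univ]

/-- Distinct coordinates of a uniformly random sign vector are uncorrelated. -/
theorem expect_sign_mul_sign (i j : ι) :
    𝔼 s : ι → ℤˣ, (((s i : ℤ) : ℝ) * ((s j : ℤ) : ℝ)) = if i = j then 1 else 0 := by
  split_ifs with h
  · subst h
    have : ∀ s : ι → ℤˣ, (((s i : ℤ) : ℝ) * ((s i : ℤ) : ℝ)) = 1 := fun s => by
      rcases Int.units_eq_one_or (s i) with h | h <;> simp [h]
    simp only [this]
    exact Fintype.expect_one
  · have key : 𝔼 s : ι → ℤˣ, (((s i : ℤ) : ℝ) * ((s j : ℤ) : ℝ)) =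
        𝔼 s : ι → ℤˣ, -(((s i : ℤ) : ℝ) * ((s j : ℤ) : ℝ)) := by
      -- Flipping the `i`-th sign is a bijection of sign vectors that negates the product.
      refine Fintype.expect_equiv (Equiv.mulLeft (Pi.mulSingle i (-1 : ℤˣ))) _ _ fun s => ?_
      have hj : (Pi.mulSingle i (-1 : ℤˣ) : ι → ℤˣ) j = 1 := by
        simp [Ne.symm h]
      simp [hj]
    rw [Finset.expect_neg_distrib] at key
    linarith

theorem expect_norm_sq_sum_sign_smul {H : Type*} [NormedAddCommGroup H] [InnerProductSpace ℝ H]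
    (v : ι → H) :
    𝔼 s : ι → ℤˣ, ‖∑ i, ((s i : ℤ) : ℝ) • v i‖ ^ 2 = ∑ i, ‖v i‖ ^ 2 := by
  have h : ∀ s : ι → ℤˣ, ‖∑ i, ((s i : ℤ) : ℝ) • v i‖ ^ 2 =
      ∑ i, ∑ j, (((s i : ℤ) : ℝ) * ((s j : ℤ) : ℝ)) * inner ℝ (v i) (v j) := fun s => by
    rw [← real_inner_self_eq_norm_sq, sum_inner]
    refine Finset.sum_congr rfl fun i _ => ?_
    rw [inner_sum]
    refine Finset.sum_congr rfl fun j _ => ?_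
    rw [real_inner_smul_left, real_inner_smul_right, mul_assoc]
  simp only [h, Finset.expect_sum_comm, ← Finset.expect_mul, expect_sign_mul_sign]
  simp

theorem expect_norm_sum_sign_smul_le {H : Type*} [NormedAddCommGroup H] [InnerProductSpace ℝ H]
    (v : ι → H) :
    𝔼 s : ι → ℤˣ, ‖∑ i, ((s i : ℤ) : ℝ) • v i‖ ≤ √(∑ i, ‖v i‖ ^ 2) := by
  apply Real.le_sqrt_of_sq_le
  -- Cauchy-Schwarz against the constant 1 bounds the first moment by the second.
  have h := Finset.expect_mul_sq_le_sq_mul_sq (Finset.univ : Finset (ι → ℤˣ))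
    (fun s => ‖∑ i, ((s i : ℤ) : ℝ) • v i‖) (fun _ => 1)
  simpa [expect_norm_sq_sum_sign_smul, Fintype.expect_one] using h

/-- The trivial lower bound in Khintchine's inequality. -/
theorem abs_le_expect_abs_sum_sign_mul (a : ι → ℝ) (k : ι) :
    |a k| ≤ 𝔼 s : ι → ℤˣ, |∑ j, ((s j : ℤ) : ℝ) * a j| := by
  -- Correlating the signed sum with `s k` isolates the coefficient `a k`.
  have h : a k = 𝔼 s : ι → ℤˣ, ((s k : ℤ) : ℝ) * ∑ j, ((s j : ℤ) : ℝ) * a j := by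
    simp only [Finset.mul_sum, ← mul_assoc, Finset.expect_sum_comm, ← Finset.expect_mul,
      expect_sign_mul_sign]
    simp
  calc |a k| = |𝔼 s : ι → ℤˣ, ((s k : ℤ) : ℝ) * ∑ j, ((s j : ℤ) : ℝ) * a j| := by rw [← h]
    _ ≤ _ := Finset.abs_expect_le _ _
    _ = _ := by
      refine Finset.expect_congr rfl fun s _ => ?_
      rw [abs_mul]
      rcases Int.units_eq_one_or (s k) with h | h <;> simp [h]

end Signs

/-! ### Contraction for vector-valued Lipschitz classes. -/

section Contraction

open scoped BigOperators

/-- A real function with bounded range. -/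
def BoundedFun {Θ : Type*} (g : Θ → ℝ) : Prop := ∃ M, ∀ θ, |g θ| ≤ M

namespace BoundedFun

variable {Θ ι : Type*} {g h : Θ → ℝ}

theorem of_finite [Finite Θ] (g : Θ → ℝ) : BoundedFun g := by
  obtain ⟨M, hM⟩ := (Set.finite_range fun θ => |g θ|).bddAbove
  exact ⟨M, fun θ => hM ⟨θ, rfl⟩⟩

theorem add (hg : BoundedFun g) (hh : BoundedFun h) : BoundedFun fun θ => g θ + h θ := by
  obtain ⟨M, hM⟩ := hg
  obtain ⟨N, hN⟩ := hh
  exact ⟨M + N, fun θ => (abs_add_le _ _).trans (add_le_add (hM θ) (hN θ))⟩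

theorem const_mul (hg : BoundedFun g) (c : ℝ) : BoundedFun fun θ => c * g θ := by
  obtain ⟨M, hM⟩ := hg
  exact ⟨|c| * M, fun θ => by rw [abs_mul]; exact mul_le_mul_of_nonneg_left (hM θ) (abs_nonneg c)⟩

theorem const (c : ℝ) : BoundedFun fun _ : Θ => c := ⟨|c|, fun _ => le_rfl⟩

theorem sum {s : Finset ι} {g : ι → Θ → ℝ} (hg : ∀ i ∈ s, BoundedFun (g i)) :
    BoundedFun fun θ => ∑ i ∈ s, g i θ := by
  classical
  induction s using Finset.induction_on with
  | empty => simpa using const 0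
  | insert i s hi ih =>
    simp only [Finset.sum_insert hi]
    exact (hg i (by simp)).add (ih fun j hj => hg j (by simp [hj]))

theorem bddAbove (hg : BoundedFun g) : BddAbove (Set.range g) := by
  obtain ⟨M, hM⟩ := hg
  exact ⟨M, by rintro _ ⟨θ, rfl⟩; exact (le_abs_self _).trans (hM θ)⟩

/-- A real supremum defaults to 0 on an unbounded family, so boundedness has to accompany every
supremum below. -/
theorem le_ciSup (hg : BoundedFun g) (θ : Θ) : g θ ≤ ⨆ θ, g θ := _root_.le_ciSup hg.bddAbove θ

theorem abs_ciSup_le [Nonempty Θ] {M : ℝ} (hg : ∀ θ, |g θ| ≤ M) : |⨆ θ, g θ| ≤ M := by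
  obtain ⟨θ⟩ := ‹Nonempty Θ›
  have : Nonempty Θ := ⟨θ⟩
  rw [abs_le]
  exact ⟨(neg_le_of_abs_le (hg θ)).trans (le_ciSup ⟨M, hg⟩ θ),
    ciSup_le fun θ => (le_abs_self _).trans (hg θ)⟩

end BoundedFun

variable {Θ κ : Type*} [Nonempty Θ] [Fintype κ] [DecidableEq κ]

theorem abs_ciSup_sub_ciSup_le {g h : Θ → ℝ} {b : ℝ} (hg : BoundedFun g) (hh : BoundedFun h)
    (hb : ∀ θ, |g θ - h θ| ≤ b) : |(⨆ θ, g θ) - ⨆ θ, h θ| ≤ b := by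
  rw [abs_sub_le_iff]
  constructor
  · rw [sub_le_iff_le_add]
    exact ciSup_le fun θ => by linarith [(abs_le.1 (hb θ)).2, hh.le_ciSup θ]
  · rw [sub_le_iff_le_add]
    exact ciSup_le fun θ => by linarith [(abs_le.1 (hb θ)).1, hg.le_ciSup θ]

/-- Replacing one real-valued function by the vector of functions in which it is Lipschitz. -/
theorem expect_sign_ciSup_le {a h : Θ → ℝ} {g : κ → Θ → ℝ} {L : ℝ} (hL : 0 ≤ L)
    (ha : BoundedFun a) (hg : ∀ k, BoundedFun (g k))
    (hlip : ∀ θ θ' M, 0 ≤ M → (∀ k, |g k θ - g k θ'| ≤ M) → |h θ - h θ'| ≤ L * M) :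
    𝔼 s : ℤˣ, ⨆ θ, (a θ + ((s : ℤ) : ℝ) * h θ) ≤
      𝔼 e : κ → ℤˣ, ⨆ θ, (a θ + L * ∑ k, ((e k : ℤ) : ℝ) * g k θ) := by
  set G : (κ → ℤˣ) → Θ → ℝ := fun e θ => L * ∑ k, ((e k : ℤ) : ℝ) * g k θ with hG
  have hGb : ∀ e, BoundedFun (G e) := fun e =>
    (BoundedFun.sum fun k _ => (hg k).const_mul _).const_mul L
  have hGneg : ∀ e θ, G (-e) θ = -G e θ := fun e θ => by simp [hG]
  have hneg : 𝔼 e : κ → ℤˣ, ⨆ θ, (a θ - G e θ) = 𝔼 e : κ → ℤˣ, ⨆ θ, (a θ + G e θ) := by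
    refine Fintype.expect_equiv (Equiv.neg _) _ _ fun e => ?_
    simp only [Equiv.neg_apply, hGneg, sub_eq_add_neg]
  have key : ∀ θ θ', (a θ + h θ) + (a θ' - h θ') ≤
      2 * 𝔼 e : κ → ℤˣ, ⨆ θ, (a θ + G e θ) := fun θ θ' => by
    -- The Lipschitz hypothesis is used with `M` the mean absolute signed sum of the coordinate
    -- differences, which dominates each of them.
    have h1 : h θ - h θ' ≤ 𝔼 e : κ → ℤˣ, |G e θ - G e θ'| := by
      refine (le_abs_self _).trans ((hlip θ θ' _ ?_
        fun k => abs_le_expect_abs_sum_sign_mul (fun k => g k θ - g k θ') k).trans_eq ?_)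
      · exact Finset.expect_nonneg fun _ _ => abs_nonneg _
      · rw [Finset.mul_expect]
        refine Finset.expect_congr rfl fun e _ => ?_
        simp only [hG, ← mul_sub, ← Finset.sum_sub_distrib, abs_mul, abs_of_nonneg hL]
    calc (a θ + h θ) + (a θ' - h θ') = (a θ + a θ') + (h θ - h θ') := by ring
      _ ≤ (a θ + a θ') + 𝔼 e : κ → ℤˣ, |G e θ - G e θ'| := by linarith
      _ = 𝔼 e : κ → ℤˣ, ((a θ + a θ') + |G e θ - G e θ'|) := by
        rw [Finset.expect_add_distrib, Fintype.expect_const]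
      _ ≤ 𝔼 e : κ → ℤˣ, ((⨆ θ, (a θ + G e θ)) + ⨆ θ, (a θ - G e θ)) := by
        refine Finset.expect_le_expect fun e _ => ?_
        have hp : BoundedFun fun θ => a θ + G e θ := ha.add (hGb e)
        have hm : BoundedFun fun θ => a θ - G e θ := by
          simpa [sub_eq_add_neg] using ha.add ((hGb e).const_mul (-1))
        have h2 := hp.le_ciSup θ
        have h3 := hp.le_ciSup θ'
        have h4 := hm.le_ciSup θ
        have h5 := hm.le_ciSup θ'
        -- The sign of the difference decides which of `θ`, `θ'` is tested in the supremum with `+G`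
        -- and which in the one with `-G`.
        rcases abs_cases (G e θ - G e θ') with ⟨h, _⟩ | ⟨h, _⟩ <;> linarith
      _ = _ := by rw [Finset.expect_add_distrib, hneg, two_mul]
  rw [Finset.expect_intUnits]
  have : (⨆ θ, (a θ + h θ)) + (⨆ θ, (a θ - h θ)) ≤ 2 * 𝔼 e : κ → ℤˣ, ⨆ θ, (a θ + G e θ) :=
    ciSup_add_ciSup_le key
  simp only [Units.val_one, Units.val_neg, Int.cast_one, Int.cast_neg, one_mul, neg_mul,
    ← sub_eq_add_neg]
  linarith

theorem Fin.expect_cons {α : Type*} [Fintype α] {n : ℕ} (F : (Fin (n + 1) → α) → ℝ) :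
    𝔼 s, F s = 𝔼 x : α, 𝔼 s : Fin n → α, F (Fin.cons x s) := by
  rw [← Finset.expect_product', Finset.univ_product_univ]
  exact (Fintype.expect_equiv (Fin.consEquiv fun _ => α) _ _ fun _ => rfl).symm

/-- A contraction inequality for vector-valued classes. -/
theorem expect_signs_ciSup_le {n : ℕ} {h : Fin n → Θ → ℝ} {g : Fin n → κ → Θ → ℝ} {L : ℝ}
    (hL : 0 ≤ L) (a : Θ → ℝ)
    (ha : BoundedFun a) (hh : ∀ i, BoundedFun (h i)) (hg : ∀ i k, BoundedFun (g i k))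
    (hlip : ∀ i θ θ' M, 0 ≤ M → (∀ k, |g i k θ - g i k θ'| ≤ M) → |h i θ - h i θ'| ≤ L * M) :
    𝔼 s : Fin n → ℤˣ, ⨆ θ, (a θ + ∑ i, ((s i : ℤ) : ℝ) * h i θ) ≤
      𝔼 e : Fin n → κ → ℤˣ, ⨆ θ, (a θ + L * ∑ i, ∑ k, ((e i k : ℤ) : ℝ) * g i k θ) := by
  -- The offset `a` must vary: it carries the head term while the tail is replaced, then the
  -- replaced tail while the head is.
  induction n generalizing a with
  | zero =>
    simp
  | succ n ih =>
    rw [Fin.expect_cons, Fin.expect_cons]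
    simp only [Fin.sum_univ_succ, Fin.cons_zero, Fin.cons_succ]
    calc 𝔼 x : ℤˣ, 𝔼 s : Fin n → ℤˣ, ⨆ θ, (a θ + (((x : ℤ) : ℝ) * h 0 θ +
            ∑ i, ((s i : ℤ) : ℝ) * h i.succ θ))
        ≤ 𝔼 x : ℤˣ, 𝔼 e : Fin n → κ → ℤˣ, ⨆ θ, ((a θ + ((x : ℤ) : ℝ) * h 0 θ) +
            L * ∑ i, ∑ k, ((e i k : ℤ) : ℝ) * g i.succ k θ) := by
          refine Finset.expect_le_expect fun x _ => ?_
          simp only [← add_assoc]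
          exact ih (fun θ => a θ + ((x : ℤ) : ℝ) * h 0 θ) (ha.add ((hh 0).const_mul _))
            (fun i => hh i.succ) (fun i => hg i.succ) (fun i => hlip i.succ)
      _ = 𝔼 e : Fin n → κ → ℤˣ, 𝔼 x : ℤˣ, ⨆ θ,
            ((a θ + L * ∑ i, ∑ k, ((e i k : ℤ) : ℝ) * g i.succ k θ) + ((x : ℤ) : ℝ) * h 0 θ) := by
          rw [Finset.expect_comm]
          simp only [add_right_comm]
      _ ≤ 𝔼 e : Fin n → κ → ℤˣ, 𝔼 x : κ → ℤˣ, ⨆ θ,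
            ((a θ + L * ∑ i, ∑ k, ((e i k : ℤ) : ℝ) * g i.succ k θ) +
              L * ∑ k, ((x k : ℤ) : ℝ) * g 0 k θ) := by
          refine Finset.expect_le_expect fun e _ => ?_
          exact expect_sign_ciSup_le hL
            (ha.add ((BoundedFun.sum fun i _ => BoundedFun.sum fun k _ =>
              (hg i.succ k).const_mul _).const_mul L)) (hg 0) (hlip 0)
      _ = _ := by
          rw [Finset.expect_comm]
          simp only [mul_add, ← add_assoc, add_right_comm]

/-- Rademacher complexity of a class of functions that are Lipschitz, with respect to the supremum
norm, in a vector of linear functions. -/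
theorem expect_signs_ciSup_le_of_inner {H : Type*} [NormedAddCommGroup H] [InnerProductSpace ℝ H]
    {n : ℕ} {h : Fin n → Θ → ℝ} {w : Θ → H} {v : Fin n → κ → H} {L R : ℝ}
    (hL : 0 ≤ L) (hR : 0 ≤ R) (hw : ∀ θ, ‖w θ‖ ≤ R) (hv : ∀ i k, ‖v i k‖ ≤ 1)
    (hh : ∀ i, BoundedFun (h i))
    (hlip : ∀ i θ θ' M, 0 ≤ M → (∀ k, |inner ℝ (w θ) (v i k) - inner ℝ (w θ') (v i k)| ≤ M) →
      |h i θ - h i θ'| ≤ L * M) :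
    𝔼 s : Fin n → ℤˣ, ⨆ θ, ∑ i, ((s i : ℤ) : ℝ) * h i θ ≤
      L * R * √(n * Fintype.card κ : ℝ) := by
  have hg : ∀ i k, BoundedFun fun θ => inner ℝ (w θ) (v i k) := fun i k =>
    ⟨R * 1, fun θ => (abs_real_inner_le_norm _ _).trans
      (mul_le_mul (hw θ) (hv i k) (norm_nonneg _) hR)⟩
  have h1 := expect_signs_ciSup_le hL (fun _ => 0) (BoundedFun.const 0) hh hg hlip
  simp only [zero_add] at h1
  refine h1.trans ?_
  have h2 : ∀ e : Fin n → κ → ℤˣ,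
      ⨆ θ, L * ∑ i, ∑ k, ((e i k : ℤ) : ℝ) * inner ℝ (w θ) (v i k) ≤
        L * R * ‖∑ j : Fin n × κ, ((e j.1 j.2 : ℤ) : ℝ) • v j.1 j.2‖ := fun e => by
    refine ciSup_le fun θ => ?_
    have : ∑ i, ∑ k, ((e i k : ℤ) : ℝ) * inner ℝ (w θ) (v i k) =
        inner ℝ (w θ) (∑ j : Fin n × κ, ((e j.1 j.2 : ℤ) : ℝ) • v j.1 j.2) := by
      rw [inner_sum, Fintype.sum_prod_type]
      simp only [real_inner_smul_right]
    rw [this, mul_assoc]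
    exact mul_le_mul_of_nonneg_left ((real_inner_le_norm _ _).trans
      (mul_le_mul_of_nonneg_right (hw θ) (norm_nonneg _))) hL
  refine (Finset.expect_le_expect fun e _ => h2 e).trans ?_
  rw [← Finset.mul_expect]
  refine mul_le_mul_of_nonneg_left ?_ (mul_nonneg hL hR)
  -- Uncurried, the signs form one family over `Fin n × κ`, to which the second-moment bound
  -- applies.
  calc 𝔼 e : Fin n → κ → ℤˣ, ‖∑ j : Fin n × κ, ((e j.1 j.2 : ℤ) : ℝ) • v j.1 j.2‖
      = 𝔼 e : Fin n × κ → ℤˣ, ‖∑ j : Fin n × κ, ((e j : ℤ) : ℝ) • v j.1 j.2‖ :=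
        (Fintype.expect_equiv (Equiv.curry _ _ _) _ _ fun _ => rfl).symm
    _ ≤ √(∑ j : Fin n × κ, ‖v j.1 j.2‖ ^ 2) :=
        expect_norm_sum_sign_smul_le fun j : Fin n × κ => v j.1 j.2
    _ ≤ √(n * Fintype.card κ : ℝ) := by
        apply Real.sqrt_le_sqrt
        calc ∑ j : Fin n × κ, ‖v j.1 j.2‖ ^ 2 ≤ ∑ _j : Fin n × κ, (1 : ℝ) :=
              Finset.sum_le_sum fun j _ => pow_le_one₀ (norm_nonneg _) (hv j.1 j.2)
          _ = _ := by simp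

end Contraction

/-! ### McDiarmid's inequality by induction on the number of coordinates. -/

section BoundedDifferences

open ProbabilityTheory

variable {Ω : Type*} [MeasurableSpace Ω] (D : Measure Ω) [IsProbabilityMeasure D]

theorem integral_pi_succ {n : ℕ} {F : (Fin (n + 1) → Ω) → ℝ} (hF : Measurable F)
    {M : ℝ} (hM : ∀ S, |F S| ≤ M) :
    ∫ S, F S ∂Measure.pi (fun _ => D) =
      ∫ x, ∫ S, F (Fin.cons x S) ∂Measure.pi (fun _ : Fin n => D) ∂D := by
  have hmp := (measurePreserving_piFinSuccAbove (fun _ : Fin (n + 1) => D) 0).symm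
  rw [← hmp.integral_comp']
  have h : ∀ y : Ω × (Fin n → Ω),
      F ((MeasurableEquiv.piFinSuccAbove (fun _ => Ω) 0).symm y) = F (Fin.cons y.1 y.2) := fun y => by
    rw [MeasurableEquiv.piFinSuccAbove_symm_apply]
    simp [Fin.insertNthEquiv]
  rw [integral_prod]
  · simp only [h]
  · exact Integrable.of_bound (hF.comp (MeasurableEquiv.measurable _)).aestronglyMeasurable M
      (Filter.Eventually.of_forall fun y => hM _)

theorem measurable_fin_cons {n : ℕ} :
    Measurable fun y : Ω × (Fin n → Ω) => (Fin.cons y.1 y.2 : Fin (n + 1) → Ω) := by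
  refine measurable_pi_iff.2 fun i => ?_
  refine Fin.cases ?_ (fun i => ?_) i
  · simpa using measurable_fst
  · simp only [Fin.cons_succ]
    exact (measurable_pi_apply i).comp measurable_snd

/-- McDiarmid's bounded differences inequality, in terms of moment generating functions. -/
theorem hasSubgaussianMGF_of_bounded_differences {n : ℕ} {g : (Fin n → Ω) → ℝ}
    (hg : Measurable g) (hbd : BoundedFun g) {b : ℝ}
    (hb : ∀ S i z, |g (Function.update S i z) - g S| ≤ b) :
    HasSubgaussianMGF (fun S => g S - ∫ S', g S' ∂Measure.pi fun _ => D)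
      (n * (‖b‖₊ / 2) ^ 2) (Measure.pi fun _ => D) := by
  obtain ⟨M, hM⟩ := hbd
  refine ⟨fun t => ?_, ?_⟩
  · have hI : ∀ᵐ S ∂(Measure.pi fun _ : Fin n => D),
        g S - ∫ S', g S' ∂(Measure.pi fun _ : Fin n => D) ∈
          Set.Icc (-M - ∫ S', g S' ∂(Measure.pi fun _ : Fin n => D))
            (M - ∫ S', g S' ∂(Measure.pi fun _ : Fin n => D)) :=
      Filter.Eventually.of_forall fun S => by
        have := abs_le.1 (hM S)
        exact ⟨by linarith, by linarith⟩
    exact integrable_exp_mul_of_mem_Icc (hg.sub_const _).aemeasurable hI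
  induction n with
  | zero =>
    intro t
    have h : ∀ S, g S = g default := fun S => by rw [Subsingleton.elim S default]
    simp only [mgf, h]
    simp
  | succ n ih =>
    intro t
    have hcons : Measurable fun y : Ω × (Fin n → Ω) => g (Fin.cons y.1 y.2) :=
      hg.comp measurable_fin_cons
    have hcons' : ∀ x, Measurable fun S : Fin n → Ω => g (Fin.cons x S) := fun x =>
      hcons.comp measurable_prodMk_left
    set ν := Measure.pi (fun _ : Fin n => D) with hν
    set m : Ω → ℝ := fun x => ∫ S, g (Fin.cons x S) ∂ν with hm
    have hmm : Measurable m :=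
      (StronglyMeasurable.integral_prod_right (f := fun x S => g (Fin.cons x S))
        hcons.stronglyMeasurable).measurable
    have hint : ∀ x, Integrable (fun S => g (Fin.cons x S)) ν := fun x =>
      Integrable.of_bound (hcons' x).aestronglyMeasurable M
        (Filter.Eventually.of_forall fun S => hM _)
    have hmM : ∀ x, |m x| ≤ M := fun x => by
      have := norm_integral_le_of_norm_le_const (μ := ν) (f := fun S => g (Fin.cons x S)) (C := M)
        (Filter.Eventually.of_forall fun S => hM _)
      simpa using this
    have hE : ∫ S, g S ∂Measure.pi (fun _ : Fin (n + 1) => D) = ∫ x, m x ∂D :=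
      integral_pi_succ D hg hM
    -- The conditional mean `m` given the first coordinate oscillates by at most `b`; Hoeffding's
    -- lemma on an interval of length `b` then makes it subgaussian.
    have hmb : ∀ x x', m x ≤ m x' + b := fun x x' => by
      have h1 : ∀ S : Fin n → Ω, g (Fin.cons x S) ≤ g (Fin.cons x' S) + b := fun S => by
        have := hb (Fin.cons x' S) 0 x
        rw [Fin.update_cons_zero] at this
        linarith [(abs_le.1 this).2]
      calc m x ≤ ∫ S, (g (Fin.cons x' S) + b) ∂ν :=
            integral_mono (hint x) ((hint x').add (integrable_const b)) h1
        _ = _ := by rw [integral_add (hint x') (integrable_const b)]; simp [hm]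
    have : Nonempty Ω := nonempty_of_isProbabilityMeasure D
    have hb0 : 0 ≤ b := by
      have := hmb (Classical.arbitrary Ω) (Classical.arbitrary Ω)
      linarith
    have hsub := (hasSubgaussianMGF_of_mem_Icc (μ := D) hmm.aemeasurable
      (a := ⨅ x, m x) (b := (⨅ x, m x) + b) (Filter.Eventually.of_forall fun x =>
        ⟨ciInf_le ⟨-M, by rintro _ ⟨y, rfl⟩; exact (abs_le.1 (hmM y)).1⟩ x, by
          rw [← sub_le_iff_le_add]
          exact le_ciInf fun y => by linarith [hmb x y]⟩))
    rw [add_sub_cancel_left] at hsub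
    have hb' : ∀ (x : Ω) (S : Fin n → Ω) i z,
        |g (Fin.cons x (Function.update S i z)) - g (Fin.cons x S)| ≤ b := fun x S i z => by
      rw [Fin.cons_update]
      exact hb _ _ _
    have hih := fun x => ih (hcons' x) (hb' x) (fun S => hM _) t
    have hexpM : ∀ S, |Real.exp (t * (g S - ∫ x, m x ∂D))| ≤
        Real.exp (|t| * (M + |∫ x, m x ∂D|)) := fun S => by
      rw [abs_of_pos (Real.exp_pos _), Real.exp_le_exp]
      refine (le_abs_self _).trans ?_
      rw [abs_mul]
      refine mul_le_mul_of_nonneg_left ?_ (abs_nonneg t)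
      exact (abs_sub _ _).trans (add_le_add (hM S) le_rfl)
    have hexpm : Measurable fun S => Real.exp (t * (g S - ∫ x, m x ∂D)) :=
      ((hg.sub_const _).const_mul t).exp
    simp only [mgf] at hih ⊢
    rw [hE, integral_pi_succ D hexpm hexpM]
    -- Splitting the deviation as (`g` minus `m`) plus (`m` minus its mean) factors the exponential:
    -- the inner factor is the inductive hypothesis on a slice, the outer one Hoeffding's lemma.
    calc ∫ x, ∫ S, Real.exp (t * (g (Fin.cons x S) - ∫ x, m x ∂D)) ∂ν ∂D
        = ∫ x, Real.exp (t * (m x - ∫ x, m x ∂D)) *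
            ∫ S, Real.exp (t * (g (Fin.cons x S) - m x)) ∂ν ∂D := by
          refine integral_congr_ae (Filter.Eventually.of_forall fun x => ?_)
          simp only [← integral_const_mul, ← Real.exp_add]
          refine integral_congr_ae (Filter.Eventually.of_forall fun S => ?_)
          simp only
          congr 1
          ring
      _ ≤ ∫ x, Real.exp (t * (m x - ∫ x, m x ∂D)) *
            Real.exp (((n * (‖b‖₊ / 2) ^ 2 : NNReal) : ℝ) * t ^ 2 / 2) ∂D := by
          refine integral_mono_of_nonneg (Filter.Eventually.of_forall fun x => ?_)
            ((hsub.integrable_exp_mul t).mul_const _) (Filter.Eventually.of_forall fun x => ?_)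
          · exact mul_nonneg (Real.exp_pos _).le (integral_nonneg fun S => (Real.exp_pos _).le)
          · exact mul_le_mul_of_nonneg_left (hih x) (Real.exp_pos _).le
      _ ≤ Real.exp ((((‖b‖₊ / 2) ^ 2 : NNReal) : ℝ) * t ^ 2 / 2) *
            Real.exp (((n * (‖b‖₊ / 2) ^ 2 : NNReal) : ℝ) * t ^ 2 / 2) := by
          rw [integral_mul_const]
          exact mul_le_mul_of_nonneg_right (hsub.mgf_le t) (Real.exp_pos _).le
      _ = _ := by
          rw [← Real.exp_add]
          congr 1
          push_cast
          ring

end BoundedDifferences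

/-! ### Symmetrization and uniform convergence. -/

section Symmetrization

open ProbabilityTheory
open scoped BigOperators

variable {Ω Θ : Type*} [MeasurableSpace Ω] [Nonempty Θ] [Countable Θ] (D : Measure Ω)
  [IsProbabilityMeasure D]

theorem abs_sign_mul_le (s : ℤˣ) (x : ℝ) : |((s : ℤ) : ℝ) * x| ≤ |x| := by
  rcases Int.units_eq_one_or s with h | h <;> simp [h]

/-- Symmetrization: the expected supremum of the deviations of the empirical means is at most twice
the Rademacher complexity. -/
theorem integral_ciSup_deviation_le {n : ℕ} {h : Θ → Ω → ℝ} (hm : ∀ θ, Measurable (h θ))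
    (h0 : ∀ θ z, 0 ≤ h θ z) (h1 : ∀ θ z, h θ z ≤ 1) {R : ℝ}
    (hR : ∀ S : Fin n → Ω, 𝔼 s : Fin n → ℤˣ, ⨆ θ, ∑ i, ((s i : ℤ) : ℝ) * h θ (S i) ≤ R) :
    ∫ S, ⨆ θ, (n * ∫ z, h θ z ∂D - ∑ i, h θ (S i)) ∂Measure.pi (fun _ : Fin n => D) ≤ 2 * R := by
  set μ := Measure.pi (fun _ : Fin n => D) with hμ
  set ρ := Measure.pi (fun _ : Fin n => D.prod D) with hρ
  set Ψ : (Fin n → ℤˣ) → (Fin n → Ω × Ω) → ℝ := fun s w =>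
    ⨆ θ, ∑ i, ((s i : ℤ) : ℝ) * (h θ (w i).2 - h θ (w i).1) with hΨ
  have habs : ∀ θ z, |h θ z| ≤ 1 := fun θ z => abs_le.2 ⟨by linarith [h0 θ z], h1 θ z⟩
  have hdiff : ∀ θ z z', |h θ z' - h θ z| ≤ 1 := fun θ z z' => by
    have := h0 θ z; have := h0 θ z'; have := h1 θ z; have := h1 θ z'
    exact abs_le.2 ⟨by linarith, by linarith⟩
  have hterm : ∀ (s : Fin n → ℤˣ) (w : Fin n → Ω × Ω) θ,
      |∑ i, ((s i : ℤ) : ℝ) * (h θ (w i).2 - h θ (w i).1)| ≤ n := fun s w θ => by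
    refine (Finset.abs_sum_le_sum_abs _ _).trans ?_
    calc _ ≤ ∑ _i : Fin n, (1 : ℝ) :=
          Finset.sum_le_sum fun i _ => (abs_sign_mul_le _ _).trans (hdiff _ _ _)
      _ = n := by simp
  have hΨb : ∀ s w, |Ψ s w| ≤ n := fun s w => BoundedFun.abs_ciSup_le (hterm s w)
  have hΨm : ∀ s, Measurable (Ψ s) := fun s => by
    refine Measurable.iSup fun θ => Finset.measurable_sum _ fun i _ => ?_
    exact (((hm θ).comp (measurable_snd.comp (measurable_pi_apply i))).sub
      ((hm θ).comp (measurable_fst.comp (measurable_pi_apply i)))).const_mul _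
  have hΨi : ∀ s, Integrable (Ψ s) ρ := fun s =>
    Integrable.of_bound (hΨm s).aestronglyMeasurable n (Filter.Eventually.of_forall fun w => hΨb s w)
  -- Exchanging the two points of the `i`-th pair flips the `i`-th sign and preserves the law, so
  -- every sign pattern has the same mean.
  have hswap : ∀ s, ∫ w, Ψ s w ∂ρ = ∫ w, Ψ 1 w ∂ρ := fun s => by
    have hmp : MeasurePreserving
        (fun (w : Fin n → Ω × Ω) i => (if s i = 1 then id else Prod.swap) (w i)) ρ ρ := by
      refine measurePreserving_pi _ _ fun i => ?_
      split_ifs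
      · exact MeasurePreserving.id _
      · exact Measure.measurePreserving_swap
    have hc : ∀ w : Fin n → Ω × Ω,
        Ψ s w = Ψ 1 (fun i => (if s i = 1 then id else Prod.swap) (w i)) := fun w => by
      refine iSup_congr fun θ => Finset.sum_congr rfl fun i _ => ?_
      rcases Int.units_eq_one_or (s i) with h | h
      · simp [h]
      · have : (-1 : ℤˣ) ≠ 1 := by decide
        simp [h, this]
    simp only [hc]
    conv_rhs => rw [← hmp.map_eq]
    rw [integral_map hmp.measurable.aemeasurable (hΨm 1).aestronglyMeasurable]
  have hΨ1 : ∫ w, Ψ 1 w ∂ρ ≤ 2 * R := by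
    have hpt : ∀ w, 𝔼 s, Ψ s w ≤ 2 * R := fun w => by
      have hb : ∀ (s : Fin n → ℤˣ) (S : Fin n → Ω),
          BoundedFun fun θ => ∑ i, ((s i : ℤ) : ℝ) * h θ (S i) := fun s S =>
        BoundedFun.sum fun i _ => BoundedFun.const_mul ⟨1, fun θ => habs θ (S i)⟩ _
      have hneg : 𝔼 s : Fin n → ℤˣ, ⨆ θ, ∑ i, (((-s) i : ℤ) : ℝ) * h θ (w i).1 =
          𝔼 s : Fin n → ℤˣ, ⨆ θ, ∑ i, ((s i : ℤ) : ℝ) * h θ (w i).1 :=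
        Fintype.expect_equiv (Equiv.neg _) _ _ fun s => rfl
      calc 𝔼 s, Ψ s w ≤ 𝔼 s : Fin n → ℤˣ, ((⨆ θ, ∑ i, ((s i : ℤ) : ℝ) * h θ (w i).2) +
              ⨆ θ, ∑ i, (((-s) i : ℤ) : ℝ) * h θ (w i).1) := by
            refine Finset.expect_le_expect fun s _ => ciSup_le fun θ => ?_
            have e : ∑ i, ((s i : ℤ) : ℝ) * (h θ (w i).2 - h θ (w i).1) =
                ∑ i, ((s i : ℤ) : ℝ) * h θ (w i).2 + ∑ i, (((-s) i : ℤ) : ℝ) * h θ (w i).1 := by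
              rw [← Finset.sum_add_distrib]
              refine Finset.sum_congr rfl fun i _ => ?_
              push_cast [Pi.neg_apply, Units.val_neg]
              ring
            rw [e]
            exact add_le_add ((hb s fun i => (w i).2).le_ciSup θ)
              ((hb (-s) fun i => (w i).1).le_ciSup θ)
        _ ≤ 2 * R := by
            rw [Finset.expect_add_distrib, hneg, two_mul]
            exact add_le_add (hR fun i => (w i).2) (hR fun i => (w i).1)
    calc ∫ w, Ψ 1 w ∂ρ = 𝔼 s : Fin n → ℤˣ, ∫ w, Ψ s w ∂ρ := by
          simp only [hswap]
          exact (Fintype.expect_const _).symm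
      _ = ∫ w, 𝔼 s : Fin n → ℤˣ, Ψ s w ∂ρ := by
          simp only [Fintype.expect_eq_sum_div_card]
          rw [integral_div, integral_finsetSum _ fun s _ => hΨi s]
      _ ≤ ∫ _w, 2 * R ∂ρ := by
          refine integral_mono ?_ (integrable_const _) hpt
          simp only [Fintype.expect_eq_sum_div_card]
          exact (integrable_finsetSum _ fun s _ => hΨi s).div_const _
      _ = 2 * R := by simp
  refine le_trans ?_ hΨ1
  set Φ : (Fin n → Ω) × (Fin n → Ω) → ℝ := fun y => Ψ 1 fun i => (y.1 i, y.2 i) with hΦ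
  have hzip : Measurable fun y : (Fin n → Ω) × (Fin n → Ω) => fun i => (y.1 i, y.2 i) :=
    measurable_pi_iff.2 fun i => ((measurable_pi_apply i).comp measurable_fst).prodMk
      ((measurable_pi_apply i).comp measurable_snd)
  have hΦm : Measurable Φ := (hΨm 1).comp hzip
  have hΦi : Integrable Φ (μ.prod μ) :=
    Integrable.of_bound hΦm.aestronglyMeasurable n (Filter.Eventually.of_forall fun y => hΨb _ _)
  have hmp := measurePreserving_arrowProdEquivProdArrow Ω Ω (Fin n) (fun _ => D) (fun _ => D)
  have e1 : ∫ w, Ψ 1 w ∂ρ = ∫ y, Φ y ∂(μ.prod μ) := by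
    rw [← hmp.integral_comp']
    rfl
  rw [e1, integral_prod _ hΦi]
  have hΦx : ∀ S, Integrable (fun S' => Φ (S, S')) μ := fun S =>
    Integrable.of_bound (hΦm.comp measurable_prodMk_left).aestronglyMeasurable n
      (Filter.Eventually.of_forall fun y => hΨb _ _)
  have hev : ∀ θ (i : Fin n), ∫ S : Fin n → Ω, h θ (S i) ∂μ = ∫ z, h θ z ∂D := fun θ i => by
    have := (measurePreserving_eval (fun _ : Fin n => D) i)
    conv_rhs => rw [← this.map_eq]
    rw [integral_map this.measurable.aemeasurable (hm θ).aestronglyMeasurable]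
  have hhi : ∀ θ (i : Fin n), Integrable (fun S : Fin n → Ω => h θ (S i)) μ := fun θ i =>
    Integrable.of_bound ((hm θ).comp (measurable_pi_apply i)).aestronglyMeasurable 1
      (Filter.Eventually.of_forall fun S => habs _ _)
  have hE0 : ∀ θ, 0 ≤ ∫ z, h θ z ∂D := fun θ => integral_nonneg fun z => h0 θ z
  have hE1 : ∀ θ, ∫ z, h θ z ∂D ≤ 1 := fun θ => by
    have := norm_integral_le_of_norm_le_const (μ := D) (f := h θ) (C := 1)
      (Filter.Eventually.of_forall fun z => habs θ z)
    rw [Real.norm_eq_abs] at this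
    simpa using (le_abs_self _).trans this
  -- The true mean is an average over a ghost sample `S'`, and a supremum of averages is at most the
  -- average of the suprema.
  have hpt : ∀ S, ⨆ θ, (n * ∫ z, h θ z ∂D - ∑ i, h θ (S i)) ≤ ∫ S', Φ (S, S') ∂μ := fun S => by
    refine ciSup_le fun θ => ?_
    have e2 : n * ∫ z, h θ z ∂D - ∑ i, h θ (S i) =
        ∫ S', ∑ i, (h θ (S' i) - h θ (S i)) ∂μ := by
      rw [integral_finsetSum (f := fun i (S' : Fin n → Ω) => h θ (S' i) - h θ (S i)) _
        fun i _ => (hhi θ i).sub (integrable_const _)]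
      simp only [integral_sub (hhi θ _) (integrable_const _), hev, Finset.sum_sub_distrib]
      simp
    rw [e2]
    refine integral_mono (integrable_finsetSum _ fun i _ => (hhi θ i).sub (integrable_const _))
      (hΦx S) fun S' => ?_
    have := BoundedFun.le_ciSup ⟨n, hterm 1 fun i => (S i, S' i)⟩ θ
    simpa [hΦ, hΨ] using this
  refine integral_mono_ae ?_ hΦi.integral_prod_left (Filter.Eventually.of_forall hpt)
  refine Integrable.of_bound (C := (n : ℝ) + n) (Measurable.aestronglyMeasurable ?_)
    (Filter.Eventually.of_forall fun S => ?_)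
  · exact Measurable.iSup fun θ => measurable_const.sub
      (Finset.measurable_sum _ fun i _ => (hm θ).comp (measurable_pi_apply i))
  · refine BoundedFun.abs_ciSup_le fun θ => (abs_sub _ _).trans (add_le_add ?_ ?_)
    · rw [abs_of_nonneg (mul_nonneg n.cast_nonneg (hE0 θ))]
      exact mul_le_of_le_one_right n.cast_nonneg (hE1 θ)
    · refine (Finset.abs_sum_le_sum_abs _ _).trans ?_
      calc _ ≤ ∑ _i : Fin n, (1 : ℝ) := Finset.sum_le_sum fun i _ => habs _ _
        _ = n := by simp

/-- Uniform convergence over a countable class, in terms of its Rademacher complexity. -/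
theorem measure_exists_deviation_le {n : ℕ} (hn : 0 < n) {h : Θ → Ω → ℝ}
    (hm : ∀ θ, Measurable (h θ)) (h0 : ∀ θ z, 0 ≤ h θ z) (h1 : ∀ θ z, h θ z ≤ 1) {R : ℝ}
    (hR : ∀ S : Fin n → Ω, 𝔼 s : Fin n → ℤˣ, ⨆ θ, ∑ i, ((s i : ℤ) : ℝ) * h θ (S i) ≤ R)
    {ε : ℝ} (hε : 0 ≤ ε) :
    (Measure.pi fun _ : Fin n => D).real
      {S | ∃ θ, 1 / (n : ℝ) * ∑ i, h θ (S i) + 2 * R / n + ε < ∫ z, h θ z ∂D} ≤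
      Real.exp (-2 * n * ε ^ 2) := by
  set φ : (Fin n → Ω) → ℝ := fun S => ⨆ θ, (n * ∫ z, h θ z ∂D - ∑ i, h θ (S i)) with hφ
  have hn' : (0 : ℝ) < n := Nat.cast_pos.2 hn
  have habs : ∀ θ z, |h θ z| ≤ 1 := fun θ z => abs_le.2 ⟨by linarith [h0 θ z], h1 θ z⟩
  have hE : ∀ θ, |∫ z, h θ z ∂D| ≤ 1 := fun θ => by
    have := norm_integral_le_of_norm_le_const (μ := D) (f := h θ) (C := 1)
      (Filter.Eventually.of_forall fun z => habs θ z)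
    simpa using this
  have hbt : ∀ (S : Fin n → Ω) θ, |n * ∫ z, h θ z ∂D - ∑ i, h θ (S i)| ≤ n + n := fun S θ => by
    refine (abs_sub _ _).trans (add_le_add ?_ ?_)
    · rw [abs_mul, abs_of_pos hn']
      exact mul_le_of_le_one_right hn'.le (hE θ)
    · refine (Finset.abs_sum_le_sum_abs _ _).trans ?_
      calc _ ≤ ∑ _i : Fin n, (1 : ℝ) := Finset.sum_le_sum fun i _ => habs _ _
        _ = n := by simp
  have hφm : Measurable φ := Measurable.iSup fun θ => measurable_const.sub
      (Finset.measurable_sum _ fun i _ => (hm θ).comp (measurable_pi_apply i))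
  have hφb : BoundedFun φ := ⟨n + n, fun S => BoundedFun.abs_ciSup_le (hbt S)⟩
  have hφd : ∀ S i z, |φ (Function.update S i z) - φ S| ≤ 1 := fun S i z => by
    refine abs_ciSup_sub_ciSup_le ⟨_, hbt _⟩ ⟨_, hbt _⟩ fun θ => ?_
    have e : ∑ j, h θ (Function.update S i z j) - ∑ j, h θ (S j) = h θ z - h θ (S i) := by
      rw [← Finset.sum_sub_distrib, Finset.sum_eq_single i]
      · simp
      · intro j _ hj
        simp [hj]
      · simp
    have := h0 θ z; have := h0 θ (S i); have := h1 θ z; have := h1 θ (S i)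
    exact abs_le.2 ⟨by linarith, by linarith⟩
  have hsub := hasSubgaussianMGF_of_bounded_differences D hφm hφb hφd
  have hEφ := integral_ciSup_deviation_le D hm h0 h1 hR
  -- The unnormalized supremum `φ` has differences at most 1, hence variance proxy `n / 4`; at
  -- deviation `n * ε` the exponent is `-2 n ε²`.
  refine (measureReal_mono fun S hS => ?_).trans
    ((hsub.measure_ge_le (ε := n * ε) (by positivity)).trans_eq ?_)
  · obtain ⟨θ, hθ⟩ := hS
    have h2 : n * ∫ z, h θ z ∂D - ∑ i, h θ (S i) ≤ φ S := BoundedFun.le_ciSup ⟨_, hbt S⟩ θ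
    have h3 := mul_lt_mul_of_pos_left hθ hn'
    have h4 : (n : ℝ) * (1 / (n : ℝ) * ∑ i, h θ (S i) + 2 * R / n + ε) =
        ∑ i, h θ (S i) + 2 * R + n * ε := by field_simp
    rw [h4] at h3
    simp only [Set.mem_ofPred_eq]
    linarith
  · congr 1
    simp
    field_simp

end Symmetrization

namespace SPC

variable {ℓ : ℕ} {K : Fin ℓ → ℕ} {X : Type*} {d P n : ℕ}

/-! ### The ramp function. -/

section Ramp

variable {γ : ℝ}

/-- The clipped form exposes the range, the Lipschitz constant and measurability without case
splits. -/
theorem ramp_eq (hγ : 0 < γ) (z : ℝ) : ramp γ z = max 0 (min 1 (1 - z / γ)) := by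
  unfold ramp
  split_ifs with h1 h2
  · have : z / γ < 0 := div_neg_of_neg_of_pos h1 hγ
    rw [min_eq_left (by linarith), max_eq_right zero_le_one]
  · have h3 : 0 ≤ z / γ := div_nonneg (not_lt.1 h1) hγ.le
    have h4 : z / γ ≤ 1 := (div_le_one hγ).2 h2
    rw [min_eq_right (by linarith), max_eq_right (by linarith)]
  · have h4 : 1 ≤ z / γ := (one_le_div hγ).2 (not_le.1 h2).le
    rw [min_eq_right (by linarith), max_eq_left (by linarith)]

theorem ramp_nonneg (hγ : 0 < γ) (z : ℝ) : 0 ≤ ramp γ z := by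
  rw [ramp_eq hγ]
  exact le_max_left _ _

theorem ramp_le_one (hγ : 0 < γ) (z : ℝ) : ramp γ z ≤ 1 := by
  rw [ramp_eq hγ]
  exact max_le zero_le_one (min_le_left _ _)

theorem one_le_ramp (hγ : 0 < γ) {z : ℝ} (hz : z ≤ 0) : 1 ≤ ramp γ z := by
  rw [ramp_eq hγ]
  have : z / γ ≤ 0 := div_nonpos_of_nonpos_of_nonneg hz hγ.le
  rw [min_eq_left (by linarith)]
  exact le_max_right _ _

theorem abs_ramp_sub_ramp_le (hγ : 0 < γ) (z z' : ℝ) :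
    |ramp γ z - ramp γ z'| ≤ |z - z'| / γ := by
  rw [ramp_eq hγ, ramp_eq hγ]
  refine (abs_max_sub_max_le_max _ _ _ _).trans (max_le (by simp; positivity) ?_)
  refine (abs_min_sub_min_le_max _ _ _ _).trans (max_le (by simp; positivity) ?_)
  rw [show 1 - z / γ - (1 - z' / γ) = -((z - z') / γ) by ring, abs_neg, abs_div, abs_of_pos hγ]

theorem measurable_ramp (hγ : 0 < γ) : Measurable (ramp γ) := by
  have : ramp γ = fun z => max 0 (min 1 (1 - z / γ)) := funext (ramp_eq hγ)
  rw [this]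
  fun_prop

end Ramp

/-! ### Sup-norm Lipschitz bounds in the clique scores. -/

section Lipschitz

variable {C : Finset (Finset (Fin ℓ))} {f : CliqueFeatures K X d}
  {θ θ' : EuclideanSpace ℝ (Fin d)} {x : X} {M : ℝ}

theorem abs_score_sub_score_le
    (h : ∀ q ∈ C, ∀ a, |inner ℝ θ (f x q a) - inner ℝ θ' (f x q a)| ≤ M) (y : Output K) :
    |score C f θ x y - score C f θ' x y| ≤ C.card * M := by
  simp only [score, featureMap, inner_sum, ← Finset.sum_sub_distrib]
  refine (Finset.abs_sum_le_sum_abs _ _).trans ?_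
  calc _ ≤ ∑ _q ∈ C, M := Finset.sum_le_sum fun q hq => h q hq _
    _ = C.card * M := by simp

/-- Any output can be overwritten on `c` by `a`; hence no max-marginal is a supremum over the empty
set. -/
theorem nonempty_fiber [Nonempty (Output K)] (c : Finset (Fin ℓ)) (a : CliqueAssignment K c) :
    Nonempty {y : Output K // c.restrict y = a} := by
  obtain ⟨y⟩ := ‹Nonempty (Output K)›
  exact ⟨⟨fun j => if hj : j ∈ c then a ⟨j, hj⟩ else y j, by ext j; simp⟩⟩

theorem abs_maxMarginal_sub_maxMarginal_le [Nonempty (Output K)]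
    (h : ∀ q ∈ C, ∀ a, |inner ℝ θ (f x q a) - inner ℝ θ' (f x q a)| ≤ M)
    (c : Finset (Fin ℓ)) (a : CliqueAssignment K c) :
    |maxMarginal C f θ x c a - maxMarginal C f θ' x c a| ≤ C.card * M := by
  have := nonempty_fiber c a
  exact abs_ciSup_sub_ciSup_le (BoundedFun.of_finite _) (BoundedFun.of_finite _) fun y =>
    abs_score_sub_score_le h y

theorem abs_threshold_sub_threshold_le [Nonempty (Output K)] {α : ℝ} (h0 : 0 ≤ α) (h1 : α ≤ 1)
    (hM : 0 ≤ M) (h : ∀ q ∈ C, ∀ a, |inner ℝ θ (f x q a) - inner ℝ θ' (f x q a)| ≤ M) :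
    |threshold C f θ α x - threshold C f θ' α x| ≤ C.card * M := by
  have hmax : |(⨆ y, score C f θ x y) - ⨆ y, score C f θ' x y| ≤ C.card * M :=
    abs_ciSup_sub_ciSup_le (BoundedFun.of_finite _) (BoundedFun.of_finite _) fun y =>
      abs_score_sub_score_le h y
  have hmean : |1 / (numAssignments K C : ℝ) * ∑ c ∈ C, ∑ a : CliqueAssignment K c,
        maxMarginal C f θ x c a - 1 / (numAssignments K C : ℝ) * ∑ c ∈ C,
          ∑ a : CliqueAssignment K c, maxMarginal C f θ' x c a| ≤ C.card * M := by
    rw [← mul_sub]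
    simp only [← Finset.sum_sub_distrib]
    rw [abs_mul, abs_of_nonneg (by positivity), one_div, inv_mul_eq_div]
    -- This form needs no positivity of the number of assignments, so an empty `C` is covered.
    refine div_le_of_le_mul₀ (by positivity) (by positivity) ?_
    calc _ ≤ ∑ c ∈ C, ∑ _a : CliqueAssignment K c, (C.card * M : ℝ) :=
          (Finset.abs_sum_le_sum_abs _ _).trans (Finset.sum_le_sum fun c _ =>
            (Finset.abs_sum_le_sum_abs _ _).trans (Finset.sum_le_sum fun a _ =>
              abs_maxMarginal_sub_maxMarginal_le h c a))
      _ = _ := by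
          simp only [Finset.sum_const, Finset.card_univ, nsmul_eq_mul, ← Finset.sum_mul]
          rw [mul_comm, numAssignments, Nat.cast_sum]
  unfold threshold
  rw [add_sub_add_comm, ← mul_sub, ← mul_sub]
  refine (abs_add_le _ _).trans ?_
  rw [abs_mul, abs_mul, abs_of_nonneg h0, abs_of_nonneg (sub_nonneg.2 h1)]
  calc _ ≤ α * (C.card * M) + (1 - α) * (C.card * M) :=
        add_le_add (mul_le_mul_of_nonneg_left hmax h0)
          (mul_le_mul_of_nonneg_left hmean (sub_nonneg.2 h1))
    _ = C.card * M := by ring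

/-- The margin loss is Lipschitz in the clique scores with respect to the supremum norm. -/
theorem abs_jointMarginLoss_sub_jointMarginLoss_le [Nonempty (Output K)]
    {f : Fin P → CliqueFeatures K X d} {θ θ' : Fin P → EuclideanSpace ℝ (Fin d)} {α γ : ℝ}
    (h0 : 0 ≤ α) (h1 : α ≤ 1) (hγ : 0 < γ) (hM : 0 ≤ M)
    (h : ∀ p, ∀ q ∈ C, ∀ a, |inner ℝ (θ p) (f p x q a) - inner ℝ (θ' p) (f p x q a)| ≤ M)
    (y : Output K) :
    |jointMarginLoss C f θ α γ x y - jointMarginLoss C f θ' α γ x y| ≤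
      2 * C.card * P / γ * M := by
  refine (abs_ramp_sub_ramp_le hγ _ _).trans ?_
  rw [div_mul_eq_mul_div]
  refine div_le_div_of_nonneg_right ?_ hγ.le
  rw [← Finset.sum_sub_distrib]
  refine (Finset.abs_sum_le_sum_abs _ _).trans ?_
  calc _ ≤ ∑ _p : Fin P, (2 * (C.card * M) : ℝ) := Finset.sum_le_sum fun p _ => by
        rw [sub_sub_sub_comm]
        refine (abs_sub _ _).trans ?_
        rw [two_mul]
        exact add_le_add (abs_score_sub_score_le (h p) y)
          (abs_threshold_sub_threshold_le h0 h1 hM (h p))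
    _ = _ := by simp; ring

end Lipschitz

/-! ### Measurability of the losses. -/

section Measurability

variable [MeasurableSpace X] {C : Finset (Finset (Fin ℓ))}

theorem measurable_score {f : CliqueFeatures K X d}
    (hf : ∀ q ∈ C, ∀ a, Measurable fun x => f x q a) (θ : EuclideanSpace ℝ (Fin d))
    (y : Output K) : Measurable fun x => score C f θ x y :=
  measurable_const.inner (Finset.measurable_sum _ fun q hq => hf q hq _)

theorem measurable_threshold {f : CliqueFeatures K X d}
    (hf : ∀ q ∈ C, ∀ a, Measurable fun x => f x q a) (θ : EuclideanSpace ℝ (Fin d)) (α : ℝ) :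
    Measurable fun x => threshold C f θ α x :=
  ((Measurable.iSup fun y => measurable_score hf θ y).const_mul _).add
    ((Measurable.const_mul (Finset.measurable_sum _ fun _ _ => Finset.measurable_sum _ fun _ _ =>
      Measurable.iSup fun y => measurable_score hf θ y.1) _).const_mul _)

theorem measurable_jointMarginLoss {f : Fin P → CliqueFeatures K X d}
    (hf : ∀ p, ∀ q ∈ C, ∀ a, Measurable fun x => f p x q a)
    (θ : Fin P → EuclideanSpace ℝ (Fin d)) (α : ℝ) {γ : ℝ} (hγ : 0 < γ) :
    Measurable fun z : X × Output K => jointMarginLoss C f θ α γ z.1 z.2 :=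
  measurable_from_prod_countable_left fun y => (measurable_ramp hγ).comp
    (Finset.measurable_sum _ fun p _ =>
      (measurable_score (hf p) (θ p) y).sub (measurable_threshold (hf p) (θ p) α))

end Measurability

theorem jointLoss_le_jointMarginLoss (C : Finset (Finset (Fin ℓ)))
    (f : Fin P → CliqueFeatures K X d) (θ : Fin P → EuclideanSpace ℝ (Fin d)) (α : ℝ) {γ : ℝ}
    (hγ : 0 < γ) (x : X) (y : Output K) :
    jointLoss C f θ α x y ≤ jointMarginLoss C f θ α γ x y := by
  unfold jointLoss jointMarginLoss
  split_ifs with h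
  · exact one_le_ramp hγ (by rw [Finset.sum_sub_distrib]; linarith)
  · exact ramp_nonneg hγ _

theorem jointLoss_nonneg (C : Finset (Finset (Fin ℓ)))
    (f : Fin P → CliqueFeatures K X d) (θ : Fin P → EuclideanSpace ℝ (Fin d)) (α : ℝ)
    (x : X) (y : Output K) : 0 ≤ jointLoss C f θ α x y := by
  unfold jointLoss
  split_ifs <;> norm_num

/-- Continuity in `θ` is what permits replacing the parameter set by a countable dense subset. -/
theorem continuous_jointMarginLoss [Nonempty (Output K)] {C : Finset (Finset (Fin ℓ))}
    {f : Fin P → CliqueFeatures K X d} {α γ : ℝ} (h0 : 0 ≤ α) (h1 : α ≤ 1) (hγ : 0 < γ)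
    (hf : ∀ p, ∀ x, ∀ q ∈ C, ∀ a, ‖f p x q a‖ ≤ 1) (x : X) (y : Output K) :
    Continuous fun θ : Fin P → EuclideanSpace ℝ (Fin d) => jointMarginLoss C f θ α γ x y := by
  have hL : 0 ≤ 2 * (C.card : ℝ) * P / γ := by positivity
  refine (LipschitzWith.of_dist_le_mul (K := ⟨_, hL⟩) fun θ θ' => ?_).continuous
  rw [Real.dist_eq, dist_eq_norm]
  refine abs_jointMarginLoss_sub_jointMarginLoss_le h0 h1 hγ (norm_nonneg _)
    (fun p q hq a => ?_) y
  rw [← inner_sub_left]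
  refine (abs_real_inner_le_norm _ _).trans
    ((mul_le_of_le_one_right (norm_nonneg _) (hf p x q hq a)).trans ?_)
  exact norm_le_pi_norm (θ - θ') p

open scoped BigOperators in
/-- Rademacher complexity of the margin losses of an ensemble. -/
theorem expect_signs_jointMarginLoss_le [Nonempty (Output K)] {C : Finset (Finset (Fin ℓ))}
    {f : Fin P → CliqueFeatures K X d} {α γ B : ℝ} (hP : 0 < P) (h0 : 0 ≤ α) (h1 : α ≤ 1)
    (hγ : 0 < γ) (hB : 0 ≤ B) (hf : ∀ p, ∀ x, ∀ q ∈ C, ∀ a, ‖f p x q a‖ ≤ 1)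
    {Θ : Type*} [Nonempty Θ] (u : Θ → Fin P → EuclideanSpace ℝ (Fin d))
    (hu : ∀ t p, ‖u t p‖ ≤ B / P) (S : Fin n → X × Output K) :
    𝔼 s : Fin n → ℤˣ, ⨆ t, ∑ i, ((s i : ℤ) : ℝ) *
        jointMarginLoss C f (u t) α γ (S i).1 (S i).2 ≤
      2 * C.card * P / γ * B * √(n * numAssignments K C : ℝ) := by
  classical
  have hP' : (0 : ℝ) < P := Nat.cast_pos.2 hP
  -- One index per sub-model, clique and assignment. The parameters are concatenated into `w`, and
  -- `v` places each feature vector in the block of its sub-model.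
  let κ := Fin P × (Σ q : {q // q ∈ C}, CliqueAssignment K q.1)
  have hcard : (Fintype.card κ : ℝ) = P * numAssignments K C := by
    simp only [κ, Fintype.card_prod, Fintype.card_fin, Fintype.card_sigma, numAssignments]
    rw [Finset.sum_coe_sort C fun q => Fintype.card (CliqueAssignment K q)]
    push_cast
    rfl
  let w : Θ → PiLp 2 fun _ : Fin P => EuclideanSpace ℝ (Fin d) := fun t => WithLp.toLp 2 (u t)
  let v : Fin n → κ → PiLp 2 fun _ : Fin P => EuclideanSpace ℝ (Fin d) := fun i k =>
    PiLp.single 2 k.1 (f k.1 (S i).1 k.2.1 k.2.2)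
  have hin : ∀ t i k, inner ℝ (w t) (v i k) =
      inner ℝ (u t k.1) (f k.1 (S i).1 k.2.1 k.2.2) := fun t i k => by
    rw [PiLp.inner_apply, Finset.sum_eq_single k.1]
    · simp [w, v]
    · intro p _ hp
      simp [v, hp]
    · simp
  have hw : ∀ t, ‖w t‖ ≤ B / √P := fun t => by
    rw [PiLp.norm_eq_of_L2]
    apply Real.sqrt_le_iff.2 ⟨by positivity, ?_⟩
    calc ∑ p, ‖w t p‖ ^ 2 ≤ ∑ _p : Fin P, (B / P) ^ 2 :=
          Finset.sum_le_sum fun p _ => pow_le_pow_left₀ (norm_nonneg _) (hu t p) 2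
      _ = (B / √P) ^ 2 := by
          rw [div_pow, div_pow, Real.sq_sqrt hP'.le]
          simp
          field_simp
  have hv : ∀ i k, ‖v i k‖ ≤ 1 := fun i k => by
    rw [PiLp.norm_single]
    exact hf _ _ _ k.2.1.2 _
  have key := expect_signs_ciSup_le_of_inner (L := 2 * C.card * P / γ) (by positivity)
    (by positivity) hw hv
    (h := fun i t => jointMarginLoss C f (u t) α γ (S i).1 (S i).2)
    (fun i => ⟨1, fun t => abs_le.2
      ⟨(neg_nonpos.2 zero_le_one).trans (ramp_nonneg hγ _), ramp_le_one hγ _⟩⟩)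
    (fun i t t' M hM h => abs_jointMarginLoss_sub_jointMarginLoss_le h0 h1 hγ hM
      (fun p q hq a => by
        have := h (p, ⟨⟨q, hq⟩, a⟩)
        simpa only [hin] using this) _)
  refine key.trans_eq ?_
  -- The `√P` from the number of coordinates cancels the one in `B / √P`.
  rw [hcard, mul_left_comm, Real.sqrt_mul hP'.le]
  have : √(P : ℝ) ≠ 0 := (Real.sqrt_pos.2 hP').ne'
  field_simp

theorem card_le_numAssignments [Nonempty (Output K)] (C : Finset (Finset (Fin ℓ))) :
    C.card ≤ numAssignments K C := by
  obtain ⟨y⟩ := ‹Nonempty (Output K)›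
  rw [Finset.card_eq_sum_ones]
  exact Finset.sum_le_sum fun c _ => Fintype.card_pos_iff.2 ⟨c.restrict y⟩

end SPC

/-! ### The generalization bound. -/

theorem theorem2 :
    -- the constant is absolute; a sample is `n` independent draws from the distribution `D`
    ∃ c : ℝ, 0 < c ∧
      ∀ (X : Type*) [MeasurableSpace X] (ℓ : ℕ) (K : Fin ℓ → ℕ)
        (D : Measure (X × SPC.Output K)) [IsProbabilityMeasure D]
        (C : Finset (Finset (Fin ℓ))) (P d : ℕ) (f : Fin P → SPC.CliqueFeatures K X d)
        (α γ B : ℝ),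
        0 < P → 0 ≤ α → α ≤ 1 → 0 < γ →
        (∀ p, ∀ q ∈ C, ∀ a : SPC.CliqueAssignment K q, Measurable fun x => f p x q a) →
        (∀ p, ∀ x, ∀ q ∈ C, ∀ a : SPC.CliqueAssignment K q, ‖f p x q a‖ ≤ 1) →
        ∀ (n : ℕ) (δ : ℝ), 0 < n → 0 < δ → δ < 1 →
          Measure.pi (fun _ : Fin n => D)
            {S | ¬ ∀ θ : Fin P → EuclideanSpace ℝ (Fin d), (∀ p, ‖θ p‖ ≤ B / P) →
              ∫ z, SPC.jointLoss C f θ α z.1 z.2 ∂D ≤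
                SPC.empiricalMean S (SPC.jointMarginLoss C f θ α γ) +
                  c * SPC.numAssignments K C * B * P * √(C.card : ℝ) / (γ * √(n : ℝ)) +
                  √(8 * Real.log (2 / δ) / n)} ≤ ENNReal.ofReal δ := by
  -- One factor 2 comes from symmetrization, the other from score and threshold each contributing to
  -- the Lipschitz constant.
  refine ⟨4, by norm_num, ?_⟩
  intro X _ ℓ K D _ C P d f α γ B hP h0 h1 hγ hfm hf n δ hn hδ hδ1
  have hP' : (0 : ℝ) < P := Nat.cast_pos.2 hP
  have hn' : (0 : ℝ) < n := Nat.cast_pos.2 hn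
  have : Nonempty (SPC.Output K) :=
    (nonempty_of_isProbabilityMeasure D).map Prod.snd
  let Θ := {θ : Fin P → EuclideanSpace ℝ (Fin d) // ∀ p, ‖θ p‖ ≤ B / P}
  -- For negative `B` no parameter is admissible, so the bad event is empty.
  rcases lt_or_ge B 0 with hB | hB
  · refine (measure_mono_null (t := ∅) (fun S hS => ?_) measure_empty).le.trans zero_le
    refine hS fun θ hθ => absurd (hθ ⟨0, hP⟩) (not_le.2 ?_)
    exact (div_neg_of_neg_of_pos hB hP').trans_le (norm_nonneg _)
  have : Nonempty Θ := ⟨⟨0, fun p => by simp; positivity⟩⟩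
  -- Countability makes the supremum over parameters measurable.
  obtain ⟨T, hTc, hTd⟩ := TopologicalSpace.exists_countable_dense Θ
  have : Countable T := hTc.to_subtype
  have : Nonempty T := hTd.nonempty.to_subtype
  set h : Θ → X × SPC.Output K → ℝ := fun θ z => SPC.jointMarginLoss C f θ.1 α γ z.1 z.2 with hh
  have hh0 : ∀ θ z, 0 ≤ h θ z := fun θ z => SPC.ramp_nonneg hγ _
  have hh1 : ∀ θ z, h θ z ≤ 1 := fun θ z => SPC.ramp_le_one hγ _
  have hhm : ∀ θ, Measurable (h θ) := fun θ => SPC.measurable_jointMarginLoss hfm θ.1 α hγ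
  have hhb : ∀ θ z, ‖h θ z‖ ≤ 1 := fun θ z => by
    rw [Real.norm_of_nonneg (hh0 θ z)]
    exact hh1 θ z
  have hhc : ∀ z, Continuous fun θ => h θ z := fun z =>
    (SPC.continuous_jointMarginLoss h0 h1 hγ hf z.1 z.2).comp continuous_subtype_val
  have hhi : ∀ θ, Integrable (h θ) D := fun θ =>
    Integrable.of_bound (hhm θ).aestronglyMeasurable 1 (Filter.Eventually.of_forall (hhb θ))
  have hEc : Continuous fun θ => ∫ z, h θ z ∂D :=
    continuous_of_dominated (bound := fun _ => 1) (fun θ => (hhm θ).aestronglyMeasurable)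
      (fun θ => Filter.Eventually.of_forall (hhb θ)) (integrable_const _)
      (Filter.Eventually.of_forall hhc)
  set R : ℝ := 2 * C.card * P / γ * B * √(n * SPC.numAssignments K C : ℝ) with hR
  set ε : ℝ := √(8 * Real.log (2 / δ) / n) with hε
  have hdev := measure_exists_deviation_le (Θ := T) D hn (h := fun t => h t.1)
    (fun t => hhm t.1) (fun t => hh0 t.1) (fun t => hh1 t.1) (R := R)
    (fun S => SPC.expect_signs_jointMarginLoss_le hP h0 h1 hγ hB hf
      (fun t : T => t.1.1) (fun t p => t.1.2 p) S) (Real.sqrt_nonneg _ : 0 ≤ ε)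
  have hRn : 2 * R / n ≤
      4 * SPC.numAssignments K C * B * P * √(C.card : ℝ) / (γ * √(n : ℝ)) := by
    have hs : √(n : ℝ) ≠ 0 := (Real.sqrt_pos.2 hn').ne'
    have hs2 : √(n : ℝ) ^ 2 = n := Real.sq_sqrt hn'.le
    have hc2 : √(C.card : ℝ) ^ 2 = C.card := Real.sq_sqrt (Nat.cast_nonneg _)
    have hm2 : √(SPC.numAssignments K C : ℝ) ^ 2 = SPC.numAssignments K C :=
      Real.sq_sqrt (Nat.cast_nonneg _)
    have hcm : √(C.card : ℝ) ≤ √(SPC.numAssignments K C : ℝ) :=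
      Real.sqrt_le_sqrt (Nat.cast_le.2 (SPC.card_le_numAssignments C))
    have hle : (C.card : ℝ) * √(SPC.numAssignments K C : ℝ) ≤
        SPC.numAssignments K C * √(C.card : ℝ) := by
      calc (C.card : ℝ) * √(SPC.numAssignments K C : ℝ)
          = √(C.card : ℝ) * √(SPC.numAssignments K C : ℝ) * √(C.card : ℝ) := by
            rw [← hc2, Real.sqrt_sq (Real.sqrt_nonneg _)]; ring
        _ ≤ √(SPC.numAssignments K C : ℝ) * √(SPC.numAssignments K C : ℝ) * √(C.card : ℝ) := by
            gcongr
        _ = _ := by rw [← sq, hm2]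
    calc 2 * R / n = 4 * P * B / (γ * √(n : ℝ)) *
          (C.card * √(SPC.numAssignments K C : ℝ)) := by
          rw [hR, Real.sqrt_mul hn'.le]
          rw [← hs2, Real.sqrt_sq (Real.sqrt_nonneg _)]
          field_simp
          ring
      _ ≤ 4 * P * B / (γ * √(n : ℝ)) * (SPC.numAssignments K C * √(C.card : ℝ)) := by
          gcongr
      _ = _ := by ring
  have hlog : 0 < Real.log (2 / δ) := Real.log_pos (by rw [lt_div_iff₀ hδ]; linarith)
  -- The exponent equals `-16 log (2/δ)`, far more than is needed.
  have hexp : Real.exp (-2 * n * ε ^ 2) ≤ δ := by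
    rw [hε, Real.sq_sqrt (by positivity)]
    calc Real.exp (-2 * n * (8 * Real.log (2 / δ) / n)) ≤ Real.exp (-Real.log (2 / δ)) := by
          rw [Real.exp_le_exp]
          field_simp
          linarith
      _ = δ / 2 := by rw [Real.exp_neg, Real.exp_log (by positivity), inv_div]
      _ ≤ δ := by linarith
  refine (measure_mono fun S hS => ?_).trans ((ofReal_measureReal (measure_ne_top _ _)).symm.le.trans
    (ENNReal.ofReal_le_ofReal (hdev.trans hexp)))
  obtain ⟨θ, hS⟩ := not_forall.1 hS
  obtain ⟨hθ, hS⟩ := Classical.not_imp.1 hS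
  -- Violation by the margin loss is a strict inequality between continuous functions of the
  -- parameter, so one violating parameter forces another in `T`.
  have hopen : IsOpen {t : Θ | 1 / (n : ℝ) * ∑ i, h t (S i) + 2 * R / n + ε < ∫ z, h t z ∂D} :=
    isOpen_lt (((continuous_const.mul (continuous_finsetSum _ fun i _ => hhc (S i))).add
      continuous_const).add continuous_const) hEc
  have hmem : (⟨θ, hθ⟩ : Θ) ∈
      {t : Θ | 1 / (n : ℝ) * ∑ i, h t (S i) + 2 * R / n + ε < ∫ z, h t z ∂D} := by
    have hle : ∫ z, SPC.jointLoss C f θ α z.1 z.2 ∂D ≤ ∫ z, h ⟨θ, hθ⟩ z ∂D :=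
      integral_mono_of_nonneg
        (Filter.Eventually.of_forall fun z => SPC.jointLoss_nonneg C f θ α z.1 z.2)
        (hhi _) (Filter.Eventually.of_forall fun z =>
          SPC.jointLoss_le_jointMarginLoss C f θ α hγ z.1 z.2)
    refine lt_of_le_of_lt ?_ ((not_le.1 hS).trans_le hle)
    exact add_le_add (add_le_add le_rfl hRn) le_rfl
  obtain ⟨t, ht, htT⟩ := hTd.exists_mem_open hopen ⟨_, hmem⟩
  exact ⟨⟨t, ht⟩, htT⟩
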